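/- Let $\gamma\in(0,1)$ and $\delta\in(0,2)$, and for each $n$ let $k=k_n$ be $n^{\gamma}$ rounded to an integer (up or down). Let $\mathbb{P}_0$ be the law of the Erdős–Rényi random graph $G(n,1/2)$ on the vertex set $[n]$, and let $\mathbb{P}_1$ be the law of the planted clique model $G(n,1/2,k)$: a uniformly random set $K\subseteq[n]$ with $|K|=k$ is chosen, all pairs of vertices in $K$ are joined, and every other pair is joined independently with probability $1/2$. An algorithm queries adaptively whether pairs $i<j$ are edges of the graph $G$, each query depending on the previous answers; it is allowed at most $q=n^{\delta}$ queries and unlimited computation, and then gives an output. The risk of an algorithm $A$ with output in $\{0,1\}$ is $R(A)=\mathbb{P}_0(A(G)=1)+\mathbb{P}_1(A(G)=0)$; the presence of a planted clique is detected if $R(A)=o(1)$ as $n\to\infty$. The planted clique is found by an algorithm with output $\widehat K\subseteq[n]$ if $\mathbb{P}_1(\widehat K=K)=1-o(1)$ as $n\to\infty$. (a) If $\delta<2-2\gamma$, then detecting the presence of a planted clique is impossible: no (possibly randomized) algorithm with at most $n^\delta$ queries detects it, and in fact every such algorithm has $R(A)\ge 1-o(1)$. (b) If $2-2\gamma<\delta<1$,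 then there is a (deterministic) algorithm with at most $n^{\delta}$ queries that detects the presence of a planted clique, but finding the planted clique is impossible: every (possibly randomized) algorithm with at most $n^{\delta}$ queries has $\mathbb{P}_1(\widehat K=K)=o(1)$. (c) If $\delta>\max(2-2\gamma,1)$, then there is a (deterministic) algorithm with at most $n^{\delta}$ queries that finds the planted clique. -/

import Mathlib

open MeasureTheory ProbabilityTheory Filter Topology
open scoped ENNReal SimpleGraph

namespace PlantedClique

/-- A deterministic adaptive edge query algorithm on graphs with `n` vertices and output in `α`:
a decision tree that either stops with an output, or queries a pair `i < j` and continues with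
the subtree `no` or `yes` according to the answer. There is no restriction on computation. -/
inductive QueryAlg (n : ℕ) (α : Type) : Type
  | output (a : α) : QueryAlg n α
  | query (i j : Fin n) (hij : i < j) (no yes : QueryAlg n α) : QueryAlg n α

namespace QueryAlg

variable {n : ℕ} {α : Type}

/-- The largest number of queries that the algorithm makes, over all possible answers. -/
def queries : QueryAlg n α → ℕ
  | output _ => 0
  | query _ _ _ no yes => max no.queries yes.queries + 1

open Classical in
/-- The output of the algorithm on the graph `G`. -/
noncomputable def run (G : SimpleGraph (Fin n)) : QueryAlg n α → α
  | output a => a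
  | query i j _ no yes => if G.Adj i j then yes.run G else no.run G

end QueryAlg

/-- A randomized algorithm: a deterministic algorithm is drawn from a probability distribution,
independently of the graph. For the (countable) output types `Bool` and `Finset (Fin n)` there are
only countably many decision trees, so that this covers every source of internal randomness. -/
abbrev RandAlg (n : ℕ) (α : Type) : Type := PMF (QueryAlg n α)

/-- The randomized algorithm makes at most `q` queries, whatever its internal randomness and
whatever the graph. -/
def RandAlg.MakesAtMost {n : ℕ} {α : Type} (A : RandAlg n α) (q : ℝ) : Prop :=
  ∀ T ∈ A.support, (T.queries : ℝ) ≤ q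

/-- The probability of the event `E T` when `T` is drawn from `A` and, independently, a sample is
drawn from `μ`. -/
noncomputable def RandAlg.prob {n : ℕ} {α Ω : Type} [MeasurableSpace Ω] (A : RandAlg n α)
    (μ : Measure Ω) (E : QueryAlg n α → Set Ω) : ℝ :=
  (∑' T, A T * μ (E T)).toReal

/-- The graph on `V` whose edges are exactly the pairs of distinct elements of `K`. -/
def cliqueOn {V : Type} (K : Finset V) : SimpleGraph V where
  Adj u v := u ≠ v ∧ u ∈ K ∧ v ∈ K
  symm := ⟨fun _ _ h => ⟨h.1.symm, h.2.2, h.2.1⟩⟩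
  loopless := ⟨fun _ h => h.1 rfl⟩

/-- The null distribution: the Erdős–Rényi random graph `G(n, 1/2)`. -/
noncomputable def P0 (n : ℕ) : Measure (SimpleGraph (Fin n)) :=
  SimpleGraph.binomialRandom (Fin n) ⟨1 / 2, by norm_num, by norm_num⟩

/-- The planted clique model `G(n, 1/2, k)`, as the joint law of the planted set `K` and the graph:
`K` is a uniformly random set of `k` vertices, its elements are joined to each other, and all other
pairs are edges independently with probability `1/2`. -/
noncomputable def P1 (n k : ℕ) : Measure (Finset (Fin n) × SimpleGraph (Fin n)) :=
  ((uniformOn {K : Finset (Fin n) | K.card = k}).prod (P0 n)).map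
    fun p => (p.1, p.2 ⊔ cliqueOn p.1)

/-- The risk of a detection algorithm, the sum of its type I and type II error probabilities
(output `true` stands for the planted hypothesis, `false` for the null hypothesis). -/
noncomputable def risk {n : ℕ} (k : ℕ) (A : RandAlg n Bool) : ℝ :=
  A.prob (P0 n) (fun T => {G | T.run G = true}) +
    A.prob (P1 n k) (fun T => {p | T.run p.2 = false})

/-- The probability, in the planted model, that the output of the algorithm is exactly the
planted set. -/
noncomputable def successProb {n : ℕ} (k : ℕ) (A : RandAlg n (Finset (Fin n))) : ℝ :=
  A.prob (P1 n k) (fun T => {p | T.run p.2 = p.1})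

/-- A sequence of algorithms detects the presence of a planted clique: vanishing risk. -/
def Detects (k : ℕ → ℕ) (A : ∀ n, RandAlg n Bool) : Prop :=
  Tendsto (fun n => risk (k n) (A n)) atTop (𝓝 0)

/-- A sequence of algorithms finds the planted clique with probability `1 - o(1)`. -/
def Finds (k : ℕ → ℕ) (A : ∀ n, RandAlg n (Finset (Fin n))) : Prop :=
  Tendsto (fun n => successProb (k n) (A n)) atTop (𝓝 1)

/-- Some deterministic algorithms making at most `q n` queries detect the planted clique. -/
def DetectionPossible (k : ℕ → ℕ) (q : ℕ → ℝ) : Prop :=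
  ∃ T : ∀ n, QueryAlg n Bool, (∀ n, ((T n).queries : ℝ) ≤ q n) ∧
    Detects k (fun n => PMF.pure (T n))

/-- No algorithms, even randomized, making at most `q n` queries detect the planted clique;
more precisely, each of them has risk at least `1 - o(1)`. -/
def DetectionImpossible (k : ℕ → ℕ) (q : ℕ → ℝ) : Prop :=
  ∀ A : ∀ n, RandAlg n Bool, (∀ n, (A n).MakesAtMost (q n)) →
    ¬ Detects k A ∧ ∀ ε : ℝ, 0 < ε → ∀ᶠ n in atTop, 1 - ε ≤ risk (k n) (A n)

/-- Some deterministic algorithms making at most `q n` queries find the planted clique. -/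
def FindingPossible (k : ℕ → ℕ) (q : ℕ → ℝ) : Prop :=
  ∃ T : ∀ n, QueryAlg n (Finset (Fin n)), (∀ n, ((T n).queries : ℝ) ≤ q n) ∧
    Finds k (fun n => PMF.pure (T n))

/-- All algorithms, even randomized, making at most `q n` queries have success probability
`o(1)` in finding the planted clique. -/
def FindingImpossible (k : ℕ → ℕ) (q : ℕ → ℝ) : Prop :=
  ∀ A : ∀ n, RandAlg n (Finset (Fin n)), (∀ n, (A n).MakesAtMost (q n)) →
    Tendsto (fun n => successProb (k n) (A n)) atTop (𝓝 0)

end PlantedClique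

open PlantedClique

/-!
In a planted graph let `K` be the planted set, `k ≈ n ^ γ` its size and `q = n ^ δ` the number of
queries. The graph is `G ⊔ cliqueOn K` with `G` distributed as `G(n, 1/2)` and independent of `K`,
so every event can be studied for the pair `(G, K)`.

*Impossibility of detection.* Run the algorithm on `G` and on `G ⊔ cliqueOn K`. The two runs can
differ only if the run on `G` queries a pair inside `K`. The pairs queried on `G` are independent of
`K`, and each of them lies inside `K` with probability at most `(k / n) ^ 2`. Hence the risk is at
least `1 - q * (k / n) ^ 2` (`one_sub_le_errors`), and this tends to `1` if `δ < 2 - 2 * γ`.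

*Impossibility of recovery.* Write `K` as a uniformly random set of `k - 1` vertices together with a
further vertex `u`, uniform among the others. The run on the graph in which only `K \ {u}` is
planted does not depend on `u`. It touches `u` with probability at most `2 * q / (n - k + 1)`, and
if it does not touch `u`, then its output, which is also the output on the true graph, equals `K` for
at most one value of `u`. So the success probability is at most `(2 * q + 1) / (n - k + 1)`
(`success_le`), and this tends to `0` if `δ < 1`.

*Algorithms.* Query all pairs in a set `M` of about `n ^ (δ / 2) / 2` vertices. If `2 - 2 * γ < δ`,
then the mean of `|K ∩ M|` is a positive power of `n`, and by Chebyshev's inequality `K ∩ M` is much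
larger than the cliques of logarithmic size that occur in `G(n, 1/2)`. This detects the clique
(`exists_detection_alg`). Moreover `K ∩ M` is likely to be the unique largest clique in `M`
(`eq_inter_of_isClique`). Fix a subset of `K ∩ M` of logarithmic size and query all pairs that meet
it, at the cost of `O(n log n)` queries, which is affordable if `1 < δ`: its common neighbourhood is
likely to be `K` (`exists_finding_alg`). Here it matters that the subset depends on `K ∩ M` only, so
that a union bound over the vertices outside `K` suffices.

With `L = ⌈log₂ n⌉`, "logarithmic size" means `4 * L + 1`, and `K ∩ M` is required to have at least
`L * (4 * L + 3) + (4 * L + 1)` vertices; each union bound is then at most `2 ^ (-L) ≤ 1 / n`.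
-/

namespace PlantedClique

/-! ### The random graph and the planted model -/

instance instMeasurableSingletonClassGraph (n : ℕ) :
    MeasurableSingletonClass (SimpleGraph (Fin n)) where
  measurableSet_singleton G := by
    rw [← SimpleGraph.measurableEmbedding_edgeSet.measurableSet_image]
    exact Set.toFinite _ |>.measurableSet

instance instIsProbabilityMeasureP0 (n : ℕ) : IsProbabilityMeasure (P0 n) := by
  unfold P0; infer_instance

/-- Prescribed edges are all present with probability at most `(1 / 2) ^ E.card`. Equality may fail
because `E` may contain loops, which are never edges. -/
lemma P0_real_subset_edgeSet_le {n : ℕ} (E : Finset (Sym2 (Fin n))) :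
    (P0 n).real {G | (E : Set (Sym2 (Fin n))) ⊆ G.edgeSet} ≤ (1 / 2) ^ E.card := by
  have key : P0 n {G | (E : Set (Sym2 (Fin n))) ⊆ G.edgeSet} ≤ (1 / 2) ^ E.card := by
    rw [P0, SimpleGraph.binomialRandom_apply]
    refine (measure_mono (t := Set.pi (E : Set (Sym2 (Fin n))) fun _ => {True}) ?_).trans ?_
    · rintro _ ⟨G, hG, rfl⟩ e he
      simpa using hG he
    · rw [Measure.infinitePi_pi _ (by simp)]
      refine (Finset.prod_le_prod' (g := fun _ => (1 / 2 : ℝ≥0∞)) fun e _ => ?_).trans (by simp)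
      have hhalf : ((unitInterval.toNNReal ⟨1 / 2, by norm_num, by norm_num⟩ : NNReal) : ℝ≥0∞) =
          1 / 2 := by
        have : unitInterval.toNNReal ⟨1 / 2, by norm_num, by norm_num⟩ = (1 / 2 : NNReal) := by
          ext; simp
        rw [this]; simp
      have hfalse : Measure.dirac False ({True} : Set Prop) = 0 := by
        rw [Measure.dirac_apply' _ (by simp)]; simp
      rw [Measure.add_apply, Measure.smul_apply, Measure.smul_apply, hfalse, smul_zero, add_zero,
        ENNReal.smul_def, hhalf, smul_eq_mul]
      exact mul_le_of_le_one_right' prob_le_one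
  rw [measureReal_def]
  refine (ENNReal.toReal_mono (by simp) key).trans (by simp)

/-- The planted model as an average over the planted sets. -/
lemma P1_real {n k : ℕ} (hk : k ≤ n) (Q : Finset (Fin n) → SimpleGraph (Fin n) → Prop) :
    (P1 n k).real {p | Q p.1 p.2} =
      (∑ K ∈ Finset.powersetCard k Finset.univ,
        (P0 n).real {G | Q K (G ⊔ cliqueOn K)}) / n.choose k := by
  classical
  have hset : {K : Finset (Fin n) | K.card = k} =
      (Finset.powersetCard k (Finset.univ : Finset (Fin n)) : Set (Finset (Fin n))) := by
    ext; simp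
  rw [measureReal_def, P1, Measure.map_apply .of_discrete .of_discrete, hset]
  have hne : ((n.choose k : ℕ) : ℝ≥0∞) ≠ 0 := by
    exact_mod_cast (Nat.choose_pos hk).ne'
  have hu : ∀ K : Finset (Fin n), uniformOn
      (Finset.powersetCard k (Finset.univ : Finset (Fin n)) : Set (Finset (Fin n))) {K} =
      if K ∈ Finset.powersetCard k (Finset.univ : Finset (Fin n))
        then ((n.choose k : ℕ) : ℝ≥0∞)⁻¹ else 0 := by
    intro K
    rw [← Finset.coe_singleton, uniformOn_apply_finset]
    split_ifs with h
    · rw [Finset.inter_singleton_of_mem h]; simp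
    · rw [Finset.inter_singleton_of_notMem h]; simp
  rw [Measure.prod_apply .of_discrete, lintegral_fintype]
  simp only [hu, mul_ite, mul_zero]
  rw [Finset.sum_ite_mem, Finset.univ_inter, ENNReal.toReal_sum, Finset.sum_div]
  · refine Finset.sum_congr rfl fun K _ => ?_
    rw [ENNReal.toReal_mul, ENNReal.toReal_inv, ENNReal.toReal_natCast, div_eq_mul_inv]
    rfl
  · intro K _
    exact ENNReal.mul_ne_top (measure_ne_top _ _) (ENNReal.inv_ne_top.2 hne)

/-- If, for every outcome, at most `B` of the events indexed by `s` occur, then their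
probabilities sum to at most `B`. -/
lemma sum_measureReal_le_of_card_le {Ω ι : Type*} [MeasurableSpace Ω] [DiscreteMeasurableSpace Ω]
    (μ : Measure Ω) [IsProbabilityMeasure μ] (s : Finset ι) (Q : ι → Ω → Prop)
    [∀ ω, DecidablePred fun i => Q i ω] (B : ℝ)
    (h : ∀ ω, ((s.filter fun i => Q i ω).card : ℝ) ≤ B) :
    ∑ i ∈ s, μ.real {ω | Q i ω} ≤ B := by
  calc ∑ i ∈ s, μ.real {ω | Q i ω} = ∑ i ∈ s, ∫ ω, Set.indicator {ω | Q i ω} 1 ω ∂μ := by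
        exact Finset.sum_congr rfl fun i _ => (integral_indicator_one .of_discrete).symm
    _ = ∫ ω, ∑ i ∈ s, Set.indicator {ω | Q i ω} 1 ω ∂μ := by
        rw [integral_finsetSum]
        intro i _
        exact (integrable_const (1 : ℝ)).indicator .of_discrete
    _ ≤ ∫ _, B ∂μ := by
        refine integral_mono ?_ (integrable_const B) fun ω => ?_
        · refine integrable_finsetSum _ fun i _ => ?_
          exact (integrable_const (1 : ℝ)).indicator .of_discrete
        · refine le_trans (le_of_eq ?_) (h ω)
          simp [Set.indicator_apply]
    _ = B := by simp

/-! ### Randomized algorithms -/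

section Randomized

variable {n : ℕ} {α Ω : Type} [MeasurableSpace Ω]

lemma RandAlg.prob_pure (T : QueryAlg n α) (μ : Measure Ω) (E : QueryAlg n α → Set Ω) :
    RandAlg.prob (PMF.pure T) μ E = μ.real (E T) := by
  classical
  rw [RandAlg.prob, tsum_eq_single T, measureReal_def]
  · simp
  · intro T' hT'
    simp [PMF.pure_apply, hT']

lemma RandAlg.tsum_le_one (A : RandAlg n α) (μ : Measure Ω) [IsProbabilityMeasure μ]
    (E : QueryAlg n α → Set Ω) : ∑' T, A T * μ (E T) ≤ 1 := by
  rw [← A.tsum_coe]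
  exact ENNReal.tsum_le_tsum fun T => mul_le_of_le_one_right' prob_le_one

lemma RandAlg.prob_le (A : RandAlg n α) (μ : Measure Ω) [IsProbabilityMeasure μ]
    (E : QueryAlg n α → Set Ω) {b : ℝ} (hb : ∀ T ∈ A.support, μ.real (E T) ≤ b) :
    A.prob μ E ≤ b := by
  have hb0 : 0 ≤ b := by
    obtain ⟨T, hT⟩ := A.support_nonempty
    exact measureReal_nonneg.trans (hb T hT)
  refine ENNReal.toReal_le_of_le_ofReal hb0 ?_
  calc ∑' T, A T * μ (E T) ≤ ∑' T, A T * ENNReal.ofReal b := by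
        refine ENNReal.tsum_le_tsum fun T => ?_
        by_cases hT : T ∈ A.support
        · gcongr
          rw [← ofReal_measureReal]
          exact ENNReal.ofReal_le_ofReal (hb T hT)
        · simp [(A.apply_eq_zero_iff T).2 hT]
    _ = ENNReal.ofReal b := by rw [ENNReal.tsum_mul_right, A.tsum_coe, one_mul]

lemma RandAlg.le_prob_add_prob {Ω' : Type} [MeasurableSpace Ω'] (A : RandAlg n α)
    (μ : Measure Ω) [IsProbabilityMeasure μ] (ν : Measure Ω') [IsProbabilityMeasure ν]
    (E : QueryAlg n α → Set Ω) (F : QueryAlg n α → Set Ω') {b : ℝ}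
    (hb : ∀ T ∈ A.support, b ≤ μ.real (E T) + ν.real (F T)) :
    b ≤ A.prob μ E + A.prob ν F := by
  rw [RandAlg.prob, RandAlg.prob, ← ENNReal.toReal_add
    ((A.tsum_le_one μ E).trans_lt ENNReal.one_lt_top).ne
    ((A.tsum_le_one ν F).trans_lt ENNReal.one_lt_top).ne, ← ENNReal.tsum_add]
  refine (ENNReal.ofReal_le_iff_le_toReal ?_).1 ?_
  · rw [ENNReal.tsum_add]
    exact ENNReal.add_ne_top.2 ⟨((A.tsum_le_one μ E).trans_lt ENNReal.one_lt_top).ne,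
      ((A.tsum_le_one ν F).trans_lt ENNReal.one_lt_top).ne⟩
  calc ENNReal.ofReal b = ∑' T, A T * ENNReal.ofReal b := by
        rw [ENNReal.tsum_mul_right, A.tsum_coe, one_mul]
    _ ≤ _ := by
        refine ENNReal.tsum_le_tsum fun T => ?_
        by_cases hT : T ∈ A.support
        · rw [← mul_add]
          gcongr
          refine (ENNReal.ofReal_le_ofReal (hb T hT)).trans ?_
          rw [ENNReal.ofReal_add measureReal_nonneg measureReal_nonneg, ofReal_measureReal,
            ofReal_measureReal]
        · simp [(A.apply_eq_zero_iff T).2 hT]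

end Randomized

/-! ### Counting planted sets -/

lemma isProbabilityMeasure_P1 {n k : ℕ} (hk : k ≤ n) : IsProbabilityMeasure (P1 n k) := by
  have : IsProbabilityMeasure (uniformOn {K : Finset (Fin n) | K.card = k}) := by
    refine isProbabilityMeasure_uniformOn (Set.toFinite _) ?_
    obtain ⟨K, -, hK⟩ := Finset.exists_subset_card_eq (s := (Finset.univ : Finset (Fin n)))
      (n := k) (by simpa using hk)
    exact ⟨K, hK⟩
  exact Measure.isProbabilityMeasure_map (Measurable.of_discrete.aemeasurable)

section Counting

variable {n k : ℕ}

/-- A vertex lies in a uniformly random set of size `k` with probability `k / n`. -/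
lemma card_filter_mem (hk : k ≤ n) (u : Fin n) :
    (((Finset.powersetCard k Finset.univ).filter fun K : Finset (Fin n) => u ∈ K).card : ℝ) =
      k / n * n.choose k := by
  rcases k with _ | k
  · simp
  obtain ⟨n, rfl⟩ : ∃ n', n = n' + 1 := ⟨n - 1, by omega⟩
  have h := Finset.card_filter_powersetCard_subset {u} (Finset.univ : Finset (Fin (n + 1)))
    (k + 1) (by simp) (by simp)
  simp only [Finset.singleton_subset_iff, Finset.card_univ, Fintype.card_fin,
    Finset.card_singleton, Nat.add_sub_cancel] at h
  rw [h]
  have h2 : ((n : ℝ) + 1) * n.choose k = (n + 1).choose (k + 1) * (k + 1) := by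
    exact_mod_cast Nat.add_one_mul_choose_eq n k
  push_cast
  field_simp
  linarith

/-- Two vertices lie in a uniformly random set of size `k` with probability at most
`(k / n) ^ 2`. -/
lemma card_filter_mem_mem_le (hk : k ≤ n) {u v : Fin n} (huv : u ≠ v) :
    (((Finset.powersetCard k Finset.univ).filter
      fun K : Finset (Fin n) => u ∈ K ∧ v ∈ K).card : ℝ) ≤ (k / n) ^ 2 * n.choose k := by
  rcases lt_or_ge k 2 with hk2 | hk2
  · rw [Finset.card_eq_zero.2]
    · simp only [Nat.cast_zero]; positivity
    · refine Finset.filter_eq_empty_iff.2 fun K hK h => ?_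
      have h1 : ({u, v} : Finset (Fin n)) ⊆ K := by
        intro x hx
        rcases Finset.mem_insert.1 hx with rfl | hx
        · exact h.1
        · rw [Finset.mem_singleton.1 hx]; exact h.2
      have := Finset.card_le_card h1
      rw [Finset.card_pair huv, (Finset.mem_powersetCard.1 hK).2] at this
      omega
  obtain ⟨k, rfl⟩ : ∃ k', k = k' + 2 := ⟨k - 2, by omega⟩
  obtain ⟨n, rfl⟩ : ∃ n', n = n' + 2 := ⟨n - 2, by omega⟩
  have h := Finset.card_filter_powersetCard_subset {u, v} (Finset.univ : Finset (Fin (n + 2)))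
    (k + 2) (by simp) (by simp [Finset.card_pair huv])
  simp only [Finset.insert_subset_iff, Finset.singleton_subset_iff, Finset.card_univ,
    Fintype.card_fin, Finset.card_pair huv, Nat.add_sub_cancel] at h
  rw [h]
  have h1 : ((n : ℝ) + 1) * n.choose k = (n + 1).choose (k + 1) * (k + 1) := by
    exact_mod_cast Nat.add_one_mul_choose_eq n k
  have h2 : ((n : ℝ) + 2) * (n + 1).choose (k + 1) = (n + 2).choose (k + 2) * (k + 2) := by
    exact_mod_cast Nat.add_one_mul_choose_eq (n + 1) (k + 1)
  have hkn : (k : ℝ) ≤ n := by exact_mod_cast (by omega : k ≤ n)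
  have e1 : (n.choose k : ℝ) = (n + 1).choose (k + 1) * ((k + 1) / (n + 1)) := by
    field_simp; linarith
  have e2 : ((n + 1).choose (k + 1) : ℝ) = (n + 2).choose (k + 2) * ((k + 2) / (n + 2)) := by
    field_simp; linarith
  have e3 : ((k : ℝ) + 1) / (n + 1) ≤ (k + 2) / (n + 2) := by
    rw [div_le_div_iff₀ (by positivity) (by positivity)]; nlinarith
  rw [e1, e2]
  push_cast
  calc _ ≤ ((n + 2).choose (k + 2) : ℝ) * ((k + 2) / (n + 2)) * ((k + 2) / (n + 2)) := by gcongr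
    _ = _ := by ring

/-- Both sides sum `f K` over the pairs of a `(j + 1)`-element set `K` and an element of `K`. -/
lemma sum_powersetCard_succ (j : ℕ) (f : Finset (Fin n) → ℝ) :
    ((j : ℝ) + 1) * ∑ K ∈ Finset.powersetCard (j + 1) Finset.univ, f K =
      ∑ K ∈ Finset.powersetCard j Finset.univ, ∑ u ∈ Kᶜ, f (insert u K) := by
  have h : ((j : ℝ) + 1) * ∑ K ∈ Finset.powersetCard (j + 1) Finset.univ, f K =
      ∑ K ∈ Finset.powersetCard (j + 1) Finset.univ, ∑ _u ∈ K, f K := by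
    rw [Finset.mul_sum]
    refine Finset.sum_congr rfl fun K hK => ?_
    rw [Finset.sum_const, (Finset.mem_powersetCard.1 hK).2]
    simp
  rw [h, Finset.sum_sigma', Finset.sum_sigma']
  refine Finset.sum_bij' (fun p _ => ⟨p.1.erase p.2, p.2⟩) (fun p _ => ⟨insert p.2 p.1, p.2⟩)
    ?_ ?_ ?_ ?_ ?_
  · rintro ⟨K, u⟩ h
    simp only [Finset.mem_sigma, Finset.mem_powersetCard, Finset.subset_univ, true_and] at h ⊢
    simp [Finset.card_erase_of_mem h.2, h.1]
  · rintro ⟨K, u⟩ h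
    simp only [Finset.mem_sigma, Finset.mem_powersetCard, Finset.subset_univ, true_and,
      Finset.mem_compl] at h ⊢
    simp [Finset.card_insert_of_notMem h.2, h.1]
  · rintro ⟨K, u⟩ h
    simp only [Finset.mem_sigma] at h
    simp [Finset.insert_erase h.2]
  · rintro ⟨K, u⟩ h
    simp only [Finset.mem_sigma, Finset.mem_compl] at h
    simp [Finset.erase_insert h.2]
  · rintro ⟨K, u⟩ h
    simp only [Finset.mem_sigma] at h
    simp [Finset.insert_erase h.2]

end Counting

/-! ### Lower bounds on the error probabilities -/

namespace QueryAlg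

variable {n : ℕ} {α : Type}

open Classical in
/-- The set of pairs that the algorithm queries when its input is the graph `G`. -/
noncomputable def queried (G : SimpleGraph (Fin n)) : QueryAlg n α → Finset (Fin n × Fin n)
  | output _ => ∅
  | query i j _ no yes => insert (i, j) (if G.Adj i j then yes.queried G else no.queried G)

lemma card_queried_le (G : SimpleGraph (Fin n)) (T : QueryAlg n α) :
    (T.queried G).card ≤ T.queries := by
  induction T with
  | output a => simp [queried]
  | query i j hij no yes ihno ihyes =>
    rw [queried, queries]
    refine (Finset.card_insert_le _ _).trans ?_
    split_ifs <;> omega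

lemma lt_of_mem_queried (G : SimpleGraph (Fin n)) (T : QueryAlg n α) {p : Fin n × Fin n}
    (hp : p ∈ T.queried G) : p.1 < p.2 := by
  induction T with
  | output a => simp [queried] at hp
  | query i j hij no yes ihno ihyes =>
    rw [queried, Finset.mem_insert] at hp
    rcases hp with rfl | hp
    · exact hij
    · split_ifs at hp
      · exact ihyes hp
      · exact ihno hp

/-- The output is determined by the answers to the queries, so that it is the same for a graph that
agrees with `G` on the pairs queried on `G`. -/
lemma run_congr {G H : SimpleGraph (Fin n)} (T : QueryAlg n α)
    (h : ∀ p ∈ T.queried G, (G.Adj p.1 p.2 ↔ H.Adj p.1 p.2)) : T.run H = T.run G := by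
  induction T with
  | output a => rfl
  | query i j hij no yes ihno ihyes =>
    rw [queried] at h
    have hij' := h (i, j) (Finset.mem_insert_self _ _)
    have h' := fun p hp => h p (Finset.mem_insert_of_mem hp)
    simp only [run]
    by_cases hG : G.Adj i j
    · rw [if_pos hG] at h'
      rw [if_pos hG, if_pos (hij'.1 hG), ihyes h']
    · rw [if_neg hG] at h'
      rw [if_neg hG, if_neg (mt hij'.2 hG), ihno h']

end QueryAlg

/-- A planted clique changes the behaviour of an algorithm only if the algorithm, run on the graph
without the clique, queries a pair inside the planted set. This pair is independent of the planted
set, so each query hits it with probability at most `(k / n) ^ 2`. -/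
lemma one_sub_le_errors {n k : ℕ} (hk : k ≤ n) (T : QueryAlg n Bool) :
    1 - T.queries * (k / n : ℝ) ^ 2 ≤
      (P0 n).real {G | T.run G = true} + (P1 n k).real {p | T.run p.2 = false} := by
  classical
  have hC : (0 : ℝ) < n.choose k := by exact_mod_cast Nat.choose_pos hk
  have hit : ∑ K ∈ Finset.powersetCard k Finset.univ,
      (P0 n).real {G | ∃ p ∈ T.queried G, p.1 ∈ K ∧ p.2 ∈ K} ≤
        T.queries * (k / n : ℝ) ^ 2 * n.choose k := by
    refine sum_measureReal_le_of_card_le _ _ _ _ fun G => ?_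
    calc _ ≤ (((T.queried G).biUnion fun p => (Finset.powersetCard k Finset.univ).filter
            fun K : Finset (Fin n) => p.1 ∈ K ∧ p.2 ∈ K).card : ℝ) := by
          gcongr
          intro K hK
          simp only [Finset.mem_filter, Finset.mem_biUnion] at hK ⊢
          obtain ⟨hK, p, hp, h⟩ := hK
          exact ⟨p, hp, hK, h⟩
      _ ≤ ∑ p ∈ T.queried G, (((Finset.powersetCard k Finset.univ).filter
            fun K : Finset (Fin n) => p.1 ∈ K ∧ p.2 ∈ K).card : ℝ) := by
          exact_mod_cast Finset.card_biUnion_le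
      _ ≤ ∑ _p ∈ T.queried G, (k / n : ℝ) ^ 2 * n.choose k :=
          Finset.sum_le_sum fun p hp =>
            card_filter_mem_mem_le hk (T.lt_of_mem_queried G hp).ne
      _ = (T.queried G).card * ((k / n : ℝ) ^ 2 * n.choose k) := by simp
      _ ≤ T.queries * ((k / n : ℝ) ^ 2 * n.choose k) := by
          gcongr; exact_mod_cast T.card_queried_le G
      _ = _ := by ring
  have hcompl : (P0 n).real {G | T.run G = false} = 1 - (P0 n).real {G | T.run G = true} := by
    rw [← probReal_compl_eq_one_sub .of_discrete]
    congr 1; ext G; simp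
  have hK : ∀ K ∈ Finset.powersetCard k (Finset.univ : Finset (Fin n)),
      (P0 n).real {G | T.run G = false} -
        (P0 n).real {G | ∃ p ∈ T.queried G, p.1 ∈ K ∧ p.2 ∈ K} ≤
      (P0 n).real {G | T.run (G ⊔ cliqueOn K) = false} := by
    intro K _
    rw [sub_le_iff_le_add]
    refine (measureReal_mono ?_).trans (measureReal_union_le _ _)
    intro G hG
    by_cases h : ∃ p ∈ T.queried G, p.1 ∈ K ∧ p.2 ∈ K
    · exact Or.inr h
    · left
      push Not at h
      change T.run (G ⊔ cliqueOn K) = false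
      rw [T.run_congr (G := G)]
      · exact hG
      · intro p hp
        simp only [SimpleGraph.sup_adj, cliqueOn]
        have := h p hp
        tauto
  rw [P1_real hk fun _ H => T.run H = false]
  have hsum := Finset.sum_le_sum hK
  rw [Finset.sum_sub_distrib, Finset.sum_const, Finset.card_powersetCard, Finset.card_univ,
    Fintype.card_fin, nsmul_eq_mul, hcompl] at hsum
  rw [← sub_le_iff_le_add', le_div_iff₀ hC]
  nlinarith

/-- Reveal all but one element `u` of the planted set `K` by running the algorithm on the graph in
which only `K \ {u}` is planted. Unless this run touches `u`, its output is the same as that on the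
true graph, and it does not depend on `u`, which is uniform among the `n - k + 1` vertices that are
left. -/
lemma success_le {n j : ℕ} (hj : j + 1 ≤ n) (T : QueryAlg n (Finset (Fin n))) :
    (P1 n (j + 1)).real {p | T.run p.2 = p.1} ≤ (2 * T.queries + 1) / ((n : ℝ) - j) := by
  classical
  have hnj : (0 : ℝ) < (n : ℝ) - j := by
    have : ((j + 1 : ℕ) : ℝ) ≤ n := by exact_mod_cast hj
    push_cast at this; linarith
  have hC : (0 : ℝ) < n.choose (j + 1) := by exact_mod_cast Nat.choose_pos hj
  have hchoose : ((j : ℝ) + 1) * n.choose (j + 1) = n.choose j * (n - j) := by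
    have := Nat.choose_succ_right_eq n j
    have h2 : ((n.choose (j + 1) * (j + 1) : ℕ) : ℝ) = (n.choose j * (n - j) : ℕ) := by rw [this]
    rw [Nat.cast_mul, Nat.cast_mul, Nat.cast_sub (by omega)] at h2
    push_cast at h2
    linarith
  have hinner : ∀ K ∈ Finset.powersetCard j (Finset.univ : Finset (Fin n)),
      ∑ u ∈ Kᶜ, (P0 n).real {G | T.run (G ⊔ cliqueOn (insert u K)) = insert u K} ≤
        2 * T.queries + 1 := by
    intro K _
    refine sum_measureReal_le_of_card_le _ _ _ _ fun G => ?_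
    set Q := T.queried (G ⊔ cliqueOn K) with hQ
    set R := T.run (G ⊔ cliqueOn K) with hR
    have hsub : (Kᶜ.filter fun u => T.run (G ⊔ cliqueOn (insert u K)) = insert u K) ⊆
        (Q.image Prod.fst ∪ Q.image Prod.snd) ∪ Kᶜ.filter fun u => insert u K = R := by
      intro u hu
      rw [Finset.mem_filter] at hu
      by_cases hmem : u ∈ Q.image Prod.fst ∪ Q.image Prod.snd
      · exact Finset.mem_union_left _ hmem
      · refine Finset.mem_union_right _ (Finset.mem_filter.2 ⟨hu.1, ?_⟩)
        rw [← hu.2, hR]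
        refine T.run_congr fun p hp => ?_
        have h1 : p.1 ≠ u := fun h => hmem <| Finset.mem_union_left _ <|
          Finset.mem_image.2 ⟨p, hp, h⟩
        have h2 : p.2 ≠ u := fun h => hmem <| Finset.mem_union_right _ <|
          Finset.mem_image.2 ⟨p, hp, h⟩
        simp [cliqueOn, h1, h2]
    have hone : (Kᶜ.filter fun u => insert u K = R).card ≤ 1 := by
      refine Finset.card_le_one.2 fun u hu v hv => ?_
      simp only [Finset.mem_filter, Finset.mem_compl] at hu hv
      have : u ∈ insert v K := by rw [hv.2, ← hu.2]; exact Finset.mem_insert_self _ _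
      exact (Finset.mem_insert.1 this).resolve_right hu.1
    have hcard := (Finset.card_le_card hsub).trans (Finset.card_union_le _ _)
    have h3 := Finset.card_union_le (Q.image Prod.fst) (Q.image Prod.snd)
    have h4 : (Q.image Prod.fst).card ≤ Q.card := Finset.card_image_le
    have h5 : (Q.image Prod.snd).card ≤ Q.card := Finset.card_image_le
    have h6 : Q.card ≤ T.queries := T.card_queried_le _
    exact_mod_cast (by omega : _ ≤ 2 * T.queries + 1)
  have hsum := Finset.sum_le_sum hinner
  rw [← sum_powersetCard_succ j fun K => (P0 n).real {G | T.run (G ⊔ cliqueOn K) = K},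
    Finset.sum_const, Finset.card_powersetCard, Finset.card_univ, Fintype.card_fin,
    nsmul_eq_mul] at hsum
  rw [P1_real hj fun K H => T.run H = K, div_le_div_iff₀ hC hnj]
  have hj1 : (0 : ℝ) < (j : ℝ) + 1 := by positivity
  refine le_of_mul_le_mul_left ?_ hj1
  calc _ = (((j : ℝ) + 1) * ∑ K ∈ Finset.powersetCard (j + 1) Finset.univ,
        (P0 n).real {G | T.run (G ⊔ cliqueOn K) = K}) * (n - j) := by ring
    _ ≤ (n.choose j * (2 * T.queries + 1)) * (n - j) := by gcongr
    _ = (2 * T.queries + 1) * (n.choose j * (n - j)) := by ring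
    _ = (2 * T.queries + 1) * (((j : ℝ) + 1) * n.choose (j + 1)) := by rw [hchoose]
    _ = _ := by ring

/-! ### The number of planted vertices in a given set -/

/-- The variance of the hypergeometric distribution is at most its mean. -/
lemma sum_sq_card_inter_sub_le {n k : ℕ} (hk : k ≤ n) (M : Finset (Fin n)) :
    ∑ K ∈ Finset.powersetCard k Finset.univ,
      (((K ∩ M).card : ℝ) - M.card * (k / n)) ^ 2 ≤ M.card * (k / n) * n.choose k := by
  classical
  set p : ℝ := k / n with hp
  set C : ℝ := (n.choose k : ℝ) with hC
  have hp0 : 0 ≤ p := by positivity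
  have hC0 : 0 ≤ C := by positivity
  have hcard : ∀ K : Finset (Fin n), ((K ∩ M).card : ℝ) = ∑ u ∈ M, if u ∈ K then 1 else 0 := by
    intro K
    rw [Finset.inter_comm]
    simp
  have h1 : ∑ K ∈ Finset.powersetCard k Finset.univ, ((K ∩ M).card : ℝ) = M.card * p * C := by
    simp_rw [hcard]
    rw [Finset.sum_comm]
    have : ∀ u ∈ M, ∑ K ∈ Finset.powersetCard k Finset.univ, (if u ∈ K then (1 : ℝ) else 0) =
        p * C := by
      intro u _
      rw [← card_filter_mem hk u]
      simp
    rw [Finset.sum_congr rfl this]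
    simp [mul_assoc]
  have h2 : ∑ K ∈ Finset.powersetCard k Finset.univ, ((K ∩ M).card : ℝ) ^ 2 ≤
      M.card * p * C + M.card ^ 2 * p ^ 2 * C := by
    have hsq : ∀ K : Finset (Fin n), ((K ∩ M).card : ℝ) ^ 2 =
        ∑ u ∈ M, ∑ v ∈ M, if u ∈ K ∧ v ∈ K then 1 else 0 := by
      intro K
      rw [hcard, sq, Finset.sum_mul_sum]
      refine Finset.sum_congr rfl fun u _ => Finset.sum_congr rfl fun v _ => ?_
      by_cases hu : u ∈ K <;> by_cases hv : v ∈ K <;> simp [hu, hv]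
    simp_rw [hsq]
    rw [Finset.sum_comm]
    have : ∀ u ∈ M, ∑ K ∈ Finset.powersetCard k Finset.univ,
        ∑ v ∈ M, (if u ∈ K ∧ v ∈ K then (1 : ℝ) else 0) ≤ p * C + M.card * (p ^ 2 * C) := by
      intro u hu
      rw [Finset.sum_comm]
      have hv : ∀ v ∈ M, ∑ K ∈ Finset.powersetCard k Finset.univ,
          (if u ∈ K ∧ v ∈ K then (1 : ℝ) else 0) ≤ (if u = v then p * C else 0) + p ^ 2 * C := by
        intro v _
        by_cases huv : u = v
        · subst huv
          have := card_filter_mem hk u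
          simp only [and_self, Finset.sum_boole, if_true]
          rw [this]
          nlinarith [mul_nonneg (sq_nonneg p) hC0]
        · have := card_filter_mem_mem_le hk huv
          simp only [Finset.sum_boole, if_neg huv, zero_add]
          exact this
      refine (Finset.sum_le_sum hv).trans (le_of_eq ?_)
      rw [Finset.sum_add_distrib, Finset.sum_ite_eq, if_pos hu]
      simp
    refine (Finset.sum_le_sum this).trans (le_of_eq ?_)
    rw [Finset.sum_const, nsmul_eq_mul]
    ring
  calc _ = ∑ K ∈ Finset.powersetCard k Finset.univ, ((K ∩ M).card : ℝ) ^ 2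
        - 2 * (M.card * p) * ∑ K ∈ Finset.powersetCard k Finset.univ, ((K ∩ M).card : ℝ)
        + C * (M.card * p) ^ 2 := by
        rw [Finset.mul_sum, ← Finset.sum_sub_distrib]
        have : C * (M.card * p) ^ 2 =
            ∑ _K ∈ Finset.powersetCard k (Finset.univ : Finset (Fin n)),
              ((M.card : ℝ) * p) ^ 2 := by
          simp [hC]
        rw [this, ← Finset.sum_add_distrib]
        exact Finset.sum_congr rfl fun K _ => by ring
    _ ≤ _ := by rw [h1]; nlinarith

/-- Chebyshev's inequality for the number of planted vertices in `M`, with the threshold `t` at most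
half the mean. -/
lemma card_filter_card_inter_lt_le {n k : ℕ} (hk : k ≤ n) (M : Finset (Fin n)) {t : ℕ}
    (hpos : 0 < (M.card : ℝ) * (k / n)) (ht : 2 * (t : ℝ) ≤ M.card * (k / n)) :
    (((Finset.powersetCard k Finset.univ).filter fun K => (K ∩ M).card < t).card : ℝ) ≤
      4 / (M.card * (k / n)) * n.choose k := by
  set μ : ℝ := M.card * (k / n) with hμ
  have h := sum_sq_card_inter_sub_le hk M
  have h2 : ∑ K ∈ (Finset.powersetCard k Finset.univ).filter fun K => (K ∩ M).card < t,
      (μ / 2) ^ 2 ≤ μ * n.choose k := by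
    refine le_trans ?_ h
    refine (Finset.sum_le_sum fun K hK => ?_).trans
      (Finset.sum_le_sum_of_subset_of_nonneg (Finset.filter_subset _ _) fun K _ _ => sq_nonneg _)
    have : ((K ∩ M).card : ℝ) < t := by exact_mod_cast (Finset.mem_filter.1 hK).2
    nlinarith
  rw [Finset.sum_const, nsmul_eq_mul] at h2
  rw [div_mul_eq_mul_div, le_div_iff₀ hpos]
  nlinarith

/-- To bound the probability of an event in the planted model, the planted sets that meet `M` in
fewer than `t` vertices may be left out, at the cost of an error from Chebyshev's inequality. -/
lemma P1_real_le_of_le_card_inter {n k : ℕ} (hk : k ≤ n) (M : Finset (Fin n)) {t : ℕ}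
    (hpos : 0 < (M.card : ℝ) * (k / n)) (ht : 2 * (t : ℝ) ≤ M.card * (k / n))
    (Q : Finset (Fin n) → SimpleGraph (Fin n) → Prop) {b : ℝ} (hb0 : 0 ≤ b)
    (hb : ∀ K : Finset (Fin n), t ≤ (K ∩ M).card → (P0 n).real {G | Q K (G ⊔ cliqueOn K)} ≤ b) :
    (P1 n k).real {p | Q p.1 p.2} ≤ 4 / (M.card * (k / n)) + b := by
  have hC : (0 : ℝ) < n.choose k := by exact_mod_cast Nat.choose_pos hk
  rw [P1_real hk, div_le_iff₀ hC]
  calc _ ≤ ∑ K ∈ Finset.powersetCard k (Finset.univ : Finset (Fin n)),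
        ((if (K ∩ M).card < t then 1 else 0) + b) := by
        refine Finset.sum_le_sum fun K _ => ?_
        split_ifs with h
        · exact measureReal_le_one.trans (by linarith)
        · rw [zero_add]; exact hb K (not_lt.1 h)
    _ = (((Finset.powersetCard k Finset.univ).filter fun K => (K ∩ M).card < t).card : ℝ)
        + n.choose k * b := by
        rw [Finset.sum_add_distrib]; simp
    _ ≤ _ := by linarith [card_filter_card_inter_lt_le hk M hpos ht]

/-! ### Cliques and common neighbours in the random graph -/

lemma P0_real_exists_isClique_le (n s : ℕ) :
    (P0 n).real {G | ∃ S : Finset (Fin n), S.card = s ∧ G.IsClique S} ≤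
      n.choose s * (1 / 2) ^ s.choose 2 := by
  classical
  have hsub : {G : SimpleGraph (Fin n) | ∃ S : Finset (Fin n), S.card = s ∧ G.IsClique S} ⊆
      ⋃ S ∈ Finset.powersetCard s (Finset.univ : Finset (Fin n)),
        {G | ((S.offDiag.image Sym2.mk.uncurry : Finset _) : Set (Sym2 (Fin n))) ⊆ G.edgeSet} := by
    rintro G ⟨S, hS, hG⟩
    simp only [Set.mem_iUnion]
    refine ⟨S, by simp [hS], ?_⟩
    intro e he
    obtain ⟨p, hp, rfl⟩ := Finset.mem_image.1 (Finset.mem_coe.1 he)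
    obtain ⟨h1, h2, h3⟩ := Finset.mem_offDiag.1 hp
    exact hG h1 h2 h3
  refine (measureReal_mono hsub (measure_ne_top _ _)).trans
    ((measureReal_biUnion_finset_le _ _).trans ?_)
  refine (Finset.sum_le_sum fun S hS => P0_real_subset_edgeSet_le _).trans (le_of_eq ?_)
  rw [Finset.sum_congr rfl fun S hS => by
    rw [Sym2.card_image_offDiag, (Finset.mem_powersetCard.1 hS).2]]
  simp

/-- A union bound over the vertices `v` outside the planted set and over the sets `A i`. The edges at
`v` are not affected by planting. -/
lemma P0_real_exists_forall_adj_le {n : ℕ} (K : Finset (Fin n)) {ι : Type*} (F : Finset ι)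
    (A : ι → Finset (Fin n)) {a : ℕ} (ha : ∀ i ∈ F, (A i).card = a) :
    (P0 n).real {G | ∃ v ∉ K, ∃ i ∈ F, ∀ x ∈ A i, (G ⊔ cliqueOn K).Adj v x} ≤
      n * F.card * (1 / 2) ^ a := by
  classical
  have hsub : {G : SimpleGraph (Fin n) | ∃ v ∉ K, ∃ i ∈ F, ∀ x ∈ A i, (G ⊔ cliqueOn K).Adj v x} ⊆
      ⋃ p ∈ (Finset.univ : Finset (Fin n)) ×ˢ F,
        {G | (((A p.2).image fun x => s(p.1, x) : Finset _) : Set (Sym2 (Fin n))) ⊆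
          G.edgeSet} := by
    rintro G ⟨v, hv, i, hi, h⟩
    simp only [Set.mem_iUnion]
    refine ⟨(v, i), by simp [hi], ?_⟩
    intro e he
    obtain ⟨x, hx, rfl⟩ := Finset.mem_image.1 (Finset.mem_coe.1 he)
    exact (h x hx).resolve_right fun h' => hv h'.2.1
  refine (measureReal_mono hsub (measure_ne_top _ _)).trans
    ((measureReal_biUnion_finset_le _ _).trans ?_)
  refine (Finset.sum_le_sum fun S hS => P0_real_subset_edgeSet_le _).trans (le_of_eq ?_)
  rw [Finset.sum_congr rfl fun p hp => by
    rw [Finset.card_image_of_injective _ (fun x y h => Sym2.congr_right.1 h),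
      ha p.2 (Finset.mem_product.1 hp).2]]
  simp

/-- A clique in `M` that is at least as large as the planted part of `M` is equal to it. Such a
clique has few vertices outside `K`, and would otherwise contain a vertex outside `K` that is
adjacent to all but few of the planted vertices. -/
lemma eq_inter_of_isClique {n : ℕ} {G : SimpleGraph (Fin n)} {K M : Finset (Fin n)} {s : ℕ}
    (hG : ¬ ∃ S : Finset (Fin n), S.card = s ∧ G.IsClique S)
    (hK : ¬ ∃ v ∉ K, ∃ A ∈ Finset.powersetCard ((K ∩ M).card - s) (K ∩ M),
      ∀ x ∈ A, (G ⊔ cliqueOn K).Adj v x)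
    {L : Finset (Fin n)} (hLM : L ⊆ M) (hL : (G ⊔ cliqueOn K).IsClique L)
    (hcard : (K ∩ M).card ≤ L.card) : L = K ∩ M := by
  classical
  have hB : (L \ K).card < s := by
    by_contra! h
    obtain ⟨S, hS, hSs⟩ := Finset.exists_subset_card_eq h
    refine hG ⟨S, hSs, fun u hu v hv huv => ?_⟩
    have hu' := Finset.mem_sdiff.1 (hS hu)
    have hv' := Finset.mem_sdiff.1 (hS hv)
    exact (hL hu'.1 hv'.1 huv).resolve_right fun h => hu'.2 h.2.1
  have hsplit := Finset.card_sdiff_add_card_inter L K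
  have hLK : L ⊆ K := by
    intro v hv
    by_contra hvK
    have hAle : (K ∩ M).card - s ≤ (L ∩ K).card := by omega
    obtain ⟨A, hA, hAs⟩ := Finset.exists_subset_card_eq hAle
    refine hK ⟨v, hvK, A, Finset.mem_powersetCard.2 ⟨?_, hAs⟩, fun x hx => ?_⟩
    · intro x hx
      have := Finset.mem_inter.1 (hA hx)
      exact Finset.mem_inter.2 ⟨this.2, hLM this.1⟩
    · have := Finset.mem_inter.1 (hA hx)
      exact hL hv this.1 fun h => hvK (h ▸ this.2)
  exact Finset.eq_of_subset_of_card_le (Finset.subset_inter hLK hLM) hcard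

/-! ### Algorithms that query a set of pairs -/

/-- The algorithm that queries all pairs in `E` and continues as prescribed by `f`, according to
the part of the graph that it has seen. -/
lemma exists_query_finset {n : ℕ} {α : Type} (E : Finset (Sym2 (Fin n)))
    (f : SimpleGraph (Fin n) → QueryAlg n α) {b : ℕ} (hf : ∀ H, (f H).queries ≤ b) :
    ∃ T : QueryAlg n α, T.queries ≤ E.card + b ∧
      ∀ G, T.run G = (f (G ⊓ SimpleGraph.fromEdgeSet E)).run G := by
  classical
  induction E using Finset.induction_on generalizing f with
  | empty => exact ⟨f ⊥, by simpa using hf ⊥, by simp⟩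
  | insert e E he ih =>
    rw [Finset.card_insert_of_notMem he]
    have hsplit : ∀ G : SimpleGraph (Fin n),
        G ⊓ SimpleGraph.fromEdgeSet ((insert e E : Finset _) : Set (Sym2 (Fin n))) =
          (G ⊓ SimpleGraph.fromEdgeSet E) ⊔ (G ⊓ SimpleGraph.fromEdgeSet {e}) := by
      intro G
      rw [← inf_sup_left, Finset.coe_insert, Set.insert_eq, Set.union_comm,
        SimpleGraph.fromEdgeSet_union]
    have hcase : e.IsDiag ∨ ∃ i j, i < j ∧ e = s(i, j) := by
      induction e using Sym2.ind with
      | _ i j =>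
        rcases lt_trichotomy i j with h | h | h
        · exact Or.inr ⟨i, j, h, rfl⟩
        · exact Or.inl h
        · exact Or.inr ⟨j, i, h, Sym2.eq_swap⟩
    rcases hcase with hdiag | ⟨i, j, hij, rfl⟩
    · obtain ⟨T, hT, hrun⟩ := ih f hf
      refine ⟨T, by omega, fun G => ?_⟩
      have : SimpleGraph.fromEdgeSet {e} = ⊥ := by
        ext u v
        simp only [SimpleGraph.fromEdgeSet_adj, Set.mem_singleton_iff, SimpleGraph.bot_adj,
          iff_false, not_and, not_not]
        rintro rfl
        exact hdiag
      rw [hrun, hsplit, this, inf_bot_eq, sup_bot_eq]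
    · obtain ⟨T₀, hT₀, hrun₀⟩ := ih f hf
      obtain ⟨T₁, hT₁, hrun₁⟩ := ih (fun H => f (H ⊔ SimpleGraph.fromEdgeSet {s(i, j)}))
        fun H => hf _
      refine ⟨.query i j hij T₀ T₁, ?_, fun G => ?_⟩
      · rw [QueryAlg.queries]; omega
      · rw [QueryAlg.run, hsplit]
        split_ifs with h
        · rw [hrun₁]
          congr
          refine (inf_eq_right.2 ?_).symm
          intro u v huv
          simp only [SimpleGraph.fromEdgeSet_adj, Set.mem_singleton_iff] at huv
          rw [← SimpleGraph.mem_edgeSet, huv.1]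
          exact h
        · rw [hrun₀]
          have : G ⊓ SimpleGraph.fromEdgeSet {s(i, j)} = ⊥ := by
            rw [eq_bot_iff]
            intro u v huv
            simp only [SimpleGraph.inf_adj, SimpleGraph.fromEdgeSet_adj,
              Set.mem_singleton_iff] at huv
            refine h ?_
            rw [← SimpleGraph.mem_edgeSet, ← huv.2.1]
            exact huv.1
          rw [this, sup_bot_eq]

lemma isClique_inf_fromEdgeSet_sym2 {n : ℕ} (G : SimpleGraph (Fin n)) {M S : Finset (Fin n)}
    (hS : S ⊆ M) : (G ⊓ SimpleGraph.fromEdgeSet M.sym2).IsClique S ↔ G.IsClique S := by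
  refine ⟨fun h => h.mono inf_le_left, fun h u hu v hv huv => ⟨h hu hv huv, ?_⟩⟩
  simp [hS hu, hS hv, huv]

lemma card_sym2_le_sq {n : ℕ} (M : Finset (Fin n)) : M.sym2.card ≤ M.card ^ 2 := by
  rw [Finset.card_sym2, Nat.choose_two_right, Nat.add_sub_cancel]
  refine Nat.div_le_of_le_mul ?_
  nlinarith [Nat.zero_le M.card, sq_nonneg M.card, Nat.le_self_pow (n := 2) (by norm_num) M.card]

/-! ### Union bounds with logarithmic parameters -/

section Numerics

variable {n L : ℕ}

/-- The expected number of cliques of size `4 * L + 1` in the random graph. -/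
lemma choose_mul_half_pow_choose_two_le (hn : n ≤ 2 ^ L) :
    (n.choose (4 * L + 1) : ℝ) * (1 / 2) ^ (4 * L + 1).choose 2 ≤ (1 / 2) ^ L := by
  have h1 : (4 * L + 1).choose 2 = L * (4 * L + 1) + L * (4 * L + 1) := by
    rw [Nat.choose_two_right, Nat.add_sub_cancel]
    refine Nat.div_eq_of_eq_mul_left two_pos ?_
    ring
  have h2 : (n.choose (4 * L + 1) : ℝ) ≤ 2 ^ (L * (4 * L + 1)) := by
    calc (n.choose (4 * L + 1) : ℝ) ≤ (n : ℝ) ^ (4 * L + 1) := by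
          exact_mod_cast Nat.choose_le_pow _ _
      _ ≤ (2 ^ L) ^ (4 * L + 1) := by gcongr; exact_mod_cast hn
      _ = _ := by rw [← pow_mul]
  calc _ ≤ (2 : ℝ) ^ (L * (4 * L + 1)) * (1 / 2) ^ (L * (4 * L + 1) + L * (4 * L + 1)) := by
        rw [h1]; gcongr
    _ = (1 / 2) ^ (L * (4 * L + 1)) := by
        rw [pow_add, ← mul_assoc, ← mul_pow]; norm_num
    _ ≤ _ := pow_le_pow_of_le_one (by norm_num) (by norm_num) (by nlinarith)

/-- The union bound for a vertex that is adjacent to all but `4 * L + 1` of `c` planted vertices. -/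
lemma mul_choose_mul_half_pow_le (hn : n ≤ 2 ^ L) {c : ℕ} (hcn : c ≤ n)
    (hc : L * (4 * L + 3) + (4 * L + 1) ≤ c) :
    (n : ℝ) * c.choose (c - (4 * L + 1)) * (1 / 2) ^ (c - (4 * L + 1)) ≤ (1 / 2) ^ L := by
  have hn' : (n : ℝ) ≤ 2 ^ L := by exact_mod_cast hn
  have h2 : (c.choose (c - (4 * L + 1)) : ℝ) ≤ 2 ^ (L * (4 * L + 1)) := by
    rw [Nat.choose_symm (by omega)]
    calc (c.choose (4 * L + 1) : ℝ) ≤ (c : ℝ) ^ (4 * L + 1) := by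
          exact_mod_cast Nat.choose_le_pow _ _
      _ ≤ (2 ^ L) ^ (4 * L + 1) := by gcongr; exact_mod_cast hcn.trans hn
      _ = _ := by rw [← pow_mul]
  calc _ ≤ (2 : ℝ) ^ L * 2 ^ (L * (4 * L + 1)) * (1 / 2) ^ (L * (4 * L + 3)) := by
        gcongr ?_ * ?_ * ?_
        exact pow_le_pow_of_le_one (by norm_num) (by norm_num) (by omega)
    _ = (2 * (1 / 2)) ^ (L + L * (4 * L + 1)) * (1 / 2) ^ L := by
        rw [show L * (4 * L + 3) = (L + L * (4 * L + 1)) + L by ring, pow_add (1 / 2 : ℝ),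
          mul_pow, pow_add (2 : ℝ)]
        ring
    _ = _ := by norm_num

/-- The union bound for a vertex that is adjacent to `4 * L + 1` given planted vertices. -/
lemma mul_half_pow_le (hn : n ≤ 2 ^ L) :
    (n : ℝ) * (1 / 2) ^ (4 * L + 1) ≤ (1 / 2) ^ L := by
  have hn' : (n : ℝ) ≤ 2 ^ L := by exact_mod_cast hn
  calc _ ≤ (2 : ℝ) ^ L * (1 / 2) ^ (L + L) := by
        gcongr ?_ * ?_
        exact pow_le_pow_of_le_one (by norm_num) (by norm_num) (by omega)
    _ = (2 * (1 / 2)) ^ L * (1 / 2) ^ L := by rw [pow_add, mul_pow]; ring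
    _ = _ := by norm_num

end Numerics

/-! ### The detection and recovery algorithms -/

/-- The detection algorithm queries all pairs in `M` and looks for a clique of logarithmic size. -/
lemma exists_detection_alg {n k L : ℕ} (hk : k ≤ n) (hn : n ≤ 2 ^ L) (M : Finset (Fin n))
    (hpos : 0 < (M.card : ℝ) * (k / n))
    (ht : 2 * ((4 * L + 1 : ℕ) : ℝ) ≤ M.card * (k / n)) :
    ∃ T : QueryAlg n Bool, T.queries ≤ M.card ^ 2 ∧
      (P0 n).real {G | T.run G = true} + (P1 n k).real {p | T.run p.2 = false} ≤
        4 / (M.card * (k / n)) + (1 / 2) ^ L := by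
  classical
  obtain ⟨T, hT, hrun⟩ := exists_query_finset M.sym2
    (fun H => QueryAlg.output (decide (∃ S ⊆ M, S.card = 4 * L + 1 ∧ H.IsClique S)))
    (b := 0) fun H => le_rfl
  have hrun' : ∀ G, T.run G = true ↔ ∃ S ⊆ M, S.card = 4 * L + 1 ∧ G.IsClique S := by
    intro G
    rw [hrun]
    simp only [QueryAlg.run, decide_eq_true_eq]
    refine exists_congr fun S => and_congr_right fun hS => and_congr_right fun _ => ?_
    exact isClique_inf_fromEdgeSet_sym2 G hS
  refine ⟨T, by linarith [card_sym2_le_sq M], ?_⟩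
  have h0 : (P0 n).real {G | T.run G = true} ≤ (1 / 2) ^ L := by
    refine (measureReal_mono ?_ (measure_ne_top _ _)).trans
      ((P0_real_exists_isClique_le n (4 * L + 1)).trans (choose_mul_half_pow_choose_two_le hn))
    intro G hG
    obtain ⟨S, -, hS⟩ := (hrun' G).1 hG
    exact ⟨S, hS⟩
  have h1 := P1_real_le_of_le_card_inter hk M hpos ht (fun _ H => T.run H = false) le_rfl
    fun K hK => by
      refine (measureReal_mono (s₂ := ∅) ?_ (by simp)).trans (by simp)
      intro G hG
      obtain ⟨S, hS, hSc⟩ := Finset.exists_subset_card_eq hK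
      have : T.run (G ⊔ cliqueOn K) = true := by
        refine (hrun' _).2 ⟨S, hS.trans Finset.inter_subset_right, hSc, fun u hu v hv huv => ?_⟩
        exact Or.inr ⟨huv, (Finset.mem_inter.1 (hS hu)).1, (Finset.mem_inter.1 (hS hv)).1⟩
      exact absurd hG (by simp [this])
  linarith

lemma exists_clique_of_maximum_card {n : ℕ} (M : Finset (Fin n)) (H : SimpleGraph (Fin n)) :
    ∃ S ⊆ M, H.IsClique S ∧ ∀ S' ⊆ M, H.IsClique S' → S'.card ≤ S.card := by
  classical
  obtain ⟨S, hS, hmax⟩ := Finset.exists_max_image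
    (M.powerset.filter fun S : Finset (Fin n) => H.IsClique S) Finset.card ⟨∅, by simp⟩
  simp only [Finset.mem_filter, Finset.mem_powerset, and_imp] at hS hmax
  exact ⟨S, hS.1, hS.2, hmax⟩

/-- The algorithm for recovery queries all pairs in `M` and computes a largest clique in `M`, which
is likely to be the planted part of `M`. It then queries all pairs that meet a fixed subset of
logarithmic size of this clique, and outputs the common neighbourhood of this subset. -/
lemma exists_finding_alg {n k L : ℕ} (hk : k ≤ n) (hn : n ≤ 2 ^ L) (M : Finset (Fin n))
    (hpos : 0 < (M.card : ℝ) * (k / n))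
    (ht : 2 * ((L * (4 * L + 3) + (4 * L + 1) : ℕ) : ℝ) ≤ M.card * (k / n)) :
    ∃ T : QueryAlg n (Finset (Fin n)), T.queries ≤ M.card ^ 2 + (4 * L + 1) * n ∧
      1 - (4 / (M.card * (k / n)) + 3 * (1 / 2) ^ L) ≤ (P1 n k).real {p | T.run p.2 = p.1} := by
  classical
  have := isProbabilityMeasure_P1 hk
  choose clq hclqM hclq hclqmax using exists_clique_of_maximum_card M
  have hpick : ∀ C : Finset (Fin n), ∃ S ⊆ C, S.card ≤ 4 * L + 1 ∧
      (4 * L + 1 ≤ C.card → S.card = 4 * L + 1) := by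
    intro C
    by_cases h : 4 * L + 1 ≤ C.card
    · obtain ⟨S, hS, hc⟩ := Finset.exists_subset_card_eq h
      exact ⟨S, hS, hc.le, fun _ => hc⟩
    · exact ⟨∅, by simp, by simp, fun h' => absurd h' h⟩
  choose pick hpickC hpick_le hpick_eq using hpick
  have hsecond : ∀ S : Finset (Fin n), ∃ T : QueryAlg n (Finset (Fin n)),
      T.queries ≤ S.card * n ∧
        ∀ G, T.run G = Finset.univ.filter fun v => ∀ a ∈ S, a ≠ v → G.Adj v a := by
    intro S
    obtain ⟨E, hE, hmem⟩ : ∃ E : Finset (Sym2 (Fin n)), E.card ≤ S.card * n ∧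
        ∀ a ∈ S, ∀ v, s(v, a) ∈ E :=
      ⟨(S ×ˢ (Finset.univ : Finset (Fin n))).image fun p => s(p.2, p.1),
        Finset.card_image_le.trans (by simp), fun a ha v =>
          Finset.mem_image.2 ⟨(a, v), by simp [ha], rfl⟩⟩
    obtain ⟨T, hT, hrun⟩ := exists_query_finset E
      (fun H => QueryAlg.output (Finset.univ.filter fun v => ∀ a ∈ S, a ≠ v → H.Adj v a))
      (b := 0) fun H => le_rfl
    refine ⟨T, by omega, fun G => ?_⟩
    rw [hrun]
    simp only [QueryAlg.run]
    ext v
    simp only [Finset.mem_filter, Finset.mem_univ, true_and]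
    refine forall₂_congr fun a ha => imp_congr_right fun hav => ?_
    simp only [SimpleGraph.inf_adj, SimpleGraph.fromEdgeSet_adj, and_iff_left_iff_imp]
    exact fun _ => ⟨hmem a ha v, hav.symm⟩
  choose second hsecond_q hsecond_run using hsecond
  obtain ⟨T, hT, hrun⟩ := exists_query_finset M.sym2 (fun H => second (pick (clq H)))
    (b := (4 * L + 1) * n) fun H =>
      (hsecond_q _).trans (Nat.mul_le_mul_right _ (hpick_le _))
  refine ⟨T, hT.trans (by gcongr; exact card_sym2_le_sq M), ?_⟩
  -- The three events that cover a failure: a clique of logarithmic size in the random graph, a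
  -- vertex outside `K` that is adjacent to almost all of `K ∩ M`, and a vertex outside `K` that is
  -- adjacent to the whole subset that is used in the second round of queries.
  have hbad : ∀ K : Finset (Fin n), L * (4 * L + 3) + (4 * L + 1) ≤ (K ∩ M).card →
      (P0 n).real {G | ¬ T.run (G ⊔ cliqueOn K) = K} ≤ 3 * (1 / 2) ^ L := by
    intro K hK
    have e1 := (P0_real_exists_isClique_le n (4 * L + 1)).trans
      (choose_mul_half_pow_choose_two_le hn)
    have e2 := P0_real_exists_forall_adj_le K
      (Finset.powersetCard ((K ∩ M).card - (4 * L + 1)) (K ∩ M)) id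
      fun A hA => (Finset.mem_powersetCard.1 hA).2
    have e3 := P0_real_exists_forall_adj_le K ({pick (K ∩ M)} : Finset (Finset (Fin n))) id
      (a := 4 * L + 1) fun A hA => by
        rw [Finset.mem_singleton.1 hA]; exact hpick_eq _ (by omega)
    rw [Finset.card_powersetCard] at e2
    rw [Finset.card_singleton, Nat.cast_one, mul_one] at e3
    have hcn : (K ∩ M).card ≤ n := by simpa using Finset.card_le_univ (K ∩ M)
    replace e2 := e2.trans (mul_choose_mul_half_pow_le hn hcn hK)
    replace e3 := e3.trans (mul_half_pow_le hn)
    refine (measureReal_mono (s₂ := ({G | _} ∪ {G | _}) ∪ {G | _}) ?_ (measure_ne_top _ _)).trans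
      ((measureReal_union_le _ _).trans (add_le_add ((measureReal_union_le _ _).trans
        (add_le_add e1 e2)) e3) |>.trans (by linarith))
    intro G hG
    by_contra hnot
    simp only [Set.mem_union, not_or] at hnot
    obtain ⟨⟨h1, h2⟩, h3⟩ := hnot
    refine hG ?_
    set H := (G ⊔ cliqueOn K) ⊓ SimpleGraph.fromEdgeSet M.sym2 with hH
    have hclqH : clq H = K ∩ M := by
      refine eq_inter_of_isClique h1 h2 (hclqM H) ((hclq H).mono inf_le_left)
        (hclqmax H _ Finset.inter_subset_right ?_)
      rw [hH, isClique_inf_fromEdgeSet_sym2 _ Finset.inter_subset_right]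
      intro u hu v hv huv
      exact Or.inr ⟨huv, (Finset.mem_inter.1 hu).1, (Finset.mem_inter.1 hv).1⟩
    rw [hrun, hsecond_run, ← hH, hclqH]
    ext v
    simp only [Finset.mem_filter, Finset.mem_univ, true_and]
    have hpickK : ∀ a ∈ pick (K ∩ M), a ∈ K := fun a ha =>
      (Finset.mem_inter.1 (hpickC _ ha)).1
    constructor
    · intro h
      by_contra hv
      exact h3 ⟨v, hv, _, Finset.mem_singleton_self _, fun x hx =>
        h x hx fun hxv => hv (hxv ▸ hpickK x hx)⟩
    · intro hv a ha hav
      exact Or.inr ⟨hav.symm, hv, hpickK a ha⟩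
  have h1 := P1_real_le_of_le_card_inter hk M hpos ht (fun K H => ¬ T.run H = K)
    (by positivity) hbad
  have hcompl : (P1 n k).real {p | ¬ T.run p.2 = p.1} =
      1 - (P1 n k).real {p | T.run p.2 = p.1} :=
    probReal_compl_eq_one_sub .of_discrete
  linarith

/-! ### Asymptotics -/

section Asymptotics

lemma eventually_le_natCast_rpow {a : ℝ} (ha : 0 < a) (c : ℝ) :
    ∀ᶠ n : ℕ in atTop, c ≤ (n : ℝ) ^ a :=
  ((tendsto_rpow_atTop ha).comp tendsto_natCast_atTop_atTop).eventually_ge_atTop c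

lemma tendsto_natCast_rpow_neg {a : ℝ} (ha : a < 0) :
    Tendsto (fun n : ℕ => (n : ℝ) ^ a) atTop (𝓝 0) := by
  have := (tendsto_rpow_neg_atTop (neg_pos.2 ha)).comp tendsto_natCast_atTop_atTop
  simpa [Function.comp_def] using this

lemma le_two_pow_ceil_logb (n : ℕ) : n ≤ 2 ^ ⌈Real.logb 2 n⌉₊ := by
  rcases Nat.eq_zero_or_pos n with rfl | hn
  · simp
  have h : (n : ℝ) ≤ (2 : ℝ) ^ (⌈Real.logb 2 n⌉₊ : ℝ) := by
    rw [← Real.logb_le_iff_le_rpow (by norm_num) (by exact_mod_cast hn)]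
    exact Nat.le_ceil _
  rw [Real.rpow_natCast] at h
  exact_mod_cast h

lemma tendsto_ceil_logb : Tendsto (fun n : ℕ => ⌈Real.logb 2 n⌉₊) atTop atTop :=
  tendsto_nat_ceil_atTop.comp
    ((Real.tendsto_logb_atTop (by norm_num)).comp tendsto_natCast_atTop_atTop)

lemma eventually_ceil_logb_le_rpow {a : ℝ} (ha : 0 < a) :
    ∀ᶠ n : ℕ in atTop, (⌈Real.logb 2 n⌉₊ : ℝ) ≤ (n : ℝ) ^ a := by
  have hlog := ((isLittleO_log_rpow_atTop ha).comp_tendsto tendsto_natCast_atTop_atTop).bound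
    (c := 1 / 4) (by norm_num)
  filter_upwards [hlog, eventually_le_natCast_rpow ha 2, eventually_ge_atTop 1] with n h1 h2 hn
  have hn1 : (1 : ℝ) ≤ n := by exact_mod_cast hn
  simp only [Function.comp_apply, Real.norm_eq_abs] at h1
  rw [abs_of_nonneg (Real.log_nonneg hn1), abs_of_nonneg (by positivity)] at h1
  have h3 : Real.logb 2 n ≤ 2 * Real.log n := by
    rw [Real.logb, div_le_iff₀ (Real.log_pos (by norm_num))]
    nlinarith [Real.log_two_gt_d9, Real.log_nonneg hn1]
  have h4 := Nat.ceil_lt_add_one (Real.logb_nonneg (b := 2) (by norm_num) hn1)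
  linarith

end Asymptotics

section CliqueSize

variable {γ δ : ℝ} {k : ℕ → ℕ}

lemma size_le (hγ : γ ∈ Set.Ioo (0 : ℝ) 1) (hk : ∀ n : ℕ, |(k n : ℝ) - (n : ℝ) ^ γ| < 1) (n : ℕ) :
    k n ≤ n := by
  have h := (abs_lt.1 (hk n)).2
  have h2 : (n : ℝ) ^ γ ≤ n := by
    rcases Nat.eq_zero_or_pos n with rfl | hn
    · simp [Real.zero_rpow hγ.1.ne']
    · exact Real.rpow_le_self_of_one_le (by exact_mod_cast hn) hγ.2.le
  have : (k n : ℝ) < n + 1 := by linarith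
  exact_mod_cast Nat.lt_succ_iff.1 (by exact_mod_cast this)

lemma size_le_two_mul (hγ : γ ∈ Set.Ioo (0 : ℝ) 1)
    (hk : ∀ n : ℕ, |(k n : ℝ) - (n : ℝ) ^ γ| < 1) {n : ℕ} (hn : 1 ≤ n) :
    (k n : ℝ) ≤ 2 * (n : ℝ) ^ γ := by
  have h := (abs_lt.1 (hk n)).2
  have : 1 ≤ (n : ℝ) ^ γ := Real.one_le_rpow (by exact_mod_cast hn) hγ.1.le
  linarith

lemma size_pos (hγ : γ ∈ Set.Ioo (0 : ℝ) 1)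
    (hk : ∀ n : ℕ, |(k n : ℝ) - (n : ℝ) ^ γ| < 1) {n : ℕ} (hn : 1 ≤ n) : 0 < k n := by
  have h := (abs_lt.1 (hk n)).1
  have : 1 ≤ (n : ℝ) ^ γ := Real.one_le_rpow (by exact_mod_cast hn) hγ.1.le
  have : (0 : ℝ) < k n := by linarith
  exact_mod_cast this

end CliqueSize

/-! ### The three regimes -/

section Impossibility

variable {γ δ : ℝ} {k : ℕ → ℕ}

lemma detectionImpossible (hγ : γ ∈ Set.Ioo (0 : ℝ) 1)
    (hk : ∀ n : ℕ, |(k n : ℝ) - (n : ℝ) ^ γ| < 1) (h : δ < 2 - 2 * γ) :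
    DetectionImpossible k fun n => (n : ℝ) ^ δ := by
  intro A hA
  have hrisk : ∀ ε : ℝ, 0 < ε → ∀ᶠ n in atTop, 1 - ε ≤ risk (k n) (A n) := by
    intro ε hε
    have hlim : Tendsto (fun n : ℕ => 4 * (n : ℝ) ^ (δ + 2 * γ - 2)) atTop (𝓝 0) := by
      simpa using (tendsto_natCast_rpow_neg (by linarith : δ + 2 * γ - 2 < 0)).const_mul 4
    filter_upwards [hlim.eventually_le_const hε, eventually_ge_atTop 1] with n hn hn1
    have hkn := size_le hγ hk n
    have hn0 : (0 : ℝ) < n := by exact_mod_cast hn1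
    have := isProbabilityMeasure_P1 hkn
    refine RandAlg.le_prob_add_prob _ _ _ _ _ fun T hT => ?_
    refine le_trans ?_ (one_sub_le_errors hkn T)
    have hq := hA n T hT
    have hk2 := size_le_two_mul hγ hk hn1
    have : T.queries * (k n / n : ℝ) ^ 2 ≤ 4 * (n : ℝ) ^ (δ + 2 * γ - 2) := by
      calc T.queries * (k n / n : ℝ) ^ 2 ≤ (n : ℝ) ^ δ * (2 * (n : ℝ) ^ γ / n) ^ 2 := by gcongr
        _ = 4 * (n : ℝ) ^ (δ + 2 * γ - 2) := by
          rw [Real.rpow_sub hn0, Real.rpow_add hn0, mul_comm 2 γ, Real.rpow_mul hn0.le,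
            Real.rpow_two, Real.rpow_two]
          ring
    linarith
  refine ⟨fun hdet => ?_, hrisk⟩
  obtain ⟨n, h1, h2⟩ := ((hrisk (1 / 2) (by norm_num)).and
    (hdet.eventually_lt_const (u := 1 / 4) (by norm_num))).exists
  linarith

lemma findingImpossible (hγ : γ ∈ Set.Ioo (0 : ℝ) 1) (hδ : 0 < δ)
    (hk : ∀ n : ℕ, |(k n : ℝ) - (n : ℝ) ^ γ| < 1) (h : δ < 1) :
    FindingImpossible k fun n => (n : ℝ) ^ δ := by
  intro A hA
  have hlim : Tendsto (fun n : ℕ => 6 * (n : ℝ) ^ (δ - 1)) atTop (𝓝 0) := by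
    simpa using (tendsto_natCast_rpow_neg (by linarith : δ - 1 < 0)).const_mul 6
  refine squeeze_zero' (.of_forall fun n => ENNReal.toReal_nonneg) ?_ hlim
  filter_upwards [eventually_ge_atTop 1,
    eventually_le_natCast_rpow (sub_pos.2 hγ.2) 4] with n hn1 hn
  have hkn := size_le hγ hk n
  have hn0 : (0 : ℝ) < n := by exact_mod_cast hn1
  have := isProbabilityMeasure_P1 hkn
  refine RandAlg.prob_le _ _ _ fun T hT => ?_
  have hq := hA n T hT
  have hk2 := size_le_two_mul hγ hk hn1
  have hkhalf : (k n : ℝ) ≤ n / 2 := by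
    have : (n : ℝ) = (n : ℝ) ^ γ * (n : ℝ) ^ (1 - γ) := by
      rw [← Real.rpow_add hn0]; simp
    nlinarith [Real.rpow_nonneg hn0.le γ]
  have hone : 1 ≤ (n : ℝ) ^ δ := Real.one_le_rpow (by exact_mod_cast hn1) hδ.le
  obtain ⟨j, hj⟩ := Nat.exists_eq_add_one_of_ne_zero (size_pos hγ hk hn1).ne'
  rw [hj] at hkn hkhalf ⊢
  push_cast at hkhalf
  refine (success_le hkn T).trans ?_
  calc (2 * T.queries + 1) / ((n : ℝ) - j) ≤ (2 * (n : ℝ) ^ δ + (n : ℝ) ^ δ) / (n / 2) := by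
        gcongr; linarith
    _ = 6 * (n : ℝ) ^ (δ - 1) := by
        rw [Real.rpow_sub hn0, Real.rpow_one]; field_simp; ring

end Impossibility

section Algorithms

variable {γ δ : ℝ} {k : ℕ → ℕ}

/-- If `2 - 2 * γ < δ`, then about `n ^ (δ / 2) / 2` vertices contain polynomially many elements of
the planted set on average. -/
lemma eventually_exists_window (hγ : γ ∈ Set.Ioo (0 : ℝ) 1) (hδ : δ ∈ Set.Ioo (0 : ℝ) 2)
    (hk : ∀ n : ℕ, |(k n : ℝ) - (n : ℝ) ^ γ| < 1) (h : 2 - 2 * γ < δ) :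
    ∀ᶠ n : ℕ in atTop, ∃ M : Finset (Fin n), (M.card : ℝ) ^ 2 ≤ (n : ℝ) ^ δ / 4 ∧
      (n : ℝ) ^ (δ / 2 + γ - 1) / 8 ≤ M.card * (k n / n) ∧
      2 * ((⌈Real.logb 2 n⌉₊ * (4 * ⌈Real.logb 2 n⌉₊ + 3) + (4 * ⌈Real.logb 2 n⌉₊ + 1) : ℕ) : ℝ) ≤
        M.card * (k n / n) := by
  set β := δ / 2 + γ - 1 with hβ
  have hβ0 : 0 < β := by rw [hβ]; linarith
  filter_upwards [eventually_ge_atTop 1,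
    eventually_le_natCast_rpow (by linarith [hδ.1] : 0 < δ / 2) 4,
    eventually_le_natCast_rpow hγ.1 2, eventually_le_natCast_rpow (half_pos hβ0) 192,
    eventually_ceil_logb_le_rpow (by linarith : 0 < β / 4),
    tendsto_ceil_logb.eventually_ge_atTop 1] with n hn1 h1 h2 h3 hL hL1
  have hn0 : (0 : ℝ) < n := by exact_mod_cast hn1
  set m := ⌊(n : ℝ) ^ (δ / 2) / 2⌋₊ with hm
  have hmle : (m : ℝ) ≤ (n : ℝ) ^ (δ / 2) / 2 := Nat.floor_le (by positivity)
  have hmge : (n : ℝ) ^ (δ / 2) / 4 ≤ m := by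
    have := Nat.lt_floor_add_one ((n : ℝ) ^ (δ / 2) / 2)
    rw [← hm] at this
    linarith
  have hmn : m ≤ n := by
    have : (n : ℝ) ^ (δ / 2) ≤ n :=
      Real.rpow_le_self_of_one_le (by exact_mod_cast hn1) (by linarith [hδ.2])
    have : (m : ℝ) ≤ n := by linarith
    exact_mod_cast this
  obtain ⟨M, -, hM⟩ := Finset.exists_subset_card_eq
    (s := (Finset.univ : Finset (Fin n))) (n := m) (by simpa using hmn)
  have hkge : (n : ℝ) ^ γ / 2 ≤ k n := by linarith [(abs_lt.1 (hk n)).1]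
  have hμ : (n : ℝ) ^ β / 8 ≤ m * (k n / n) := by
    calc (n : ℝ) ^ β / 8 = (n : ℝ) ^ (δ / 2) / 4 * ((n : ℝ) ^ γ / 2 / n) := by
          rw [hβ, Real.rpow_sub hn0, Real.rpow_add hn0, Real.rpow_one]; ring
      _ ≤ _ := by gcongr
  refine ⟨M, ?_, by rwa [hM], ?_⟩
  · rw [hM]
    calc (m : ℝ) ^ 2 ≤ ((n : ℝ) ^ (δ / 2) / 2) ^ 2 := by gcongr
      _ = (n : ℝ) ^ δ / 4 := by
        rw [div_pow, ← Real.rpow_two, ← Real.rpow_mul hn0.le]; norm_num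
  · rw [hM]
    refine le_trans ?_ hμ
    -- The threshold is at most `12 * L ^ 2`, and `L` is at most the power `β / 4` of `n`.
    have hL1' : (1 : ℝ) ≤ ⌈Real.logb 2 n⌉₊ := by exact_mod_cast hL1
    have e1 : ((n : ℝ) ^ (β / 4)) ^ 2 = (n : ℝ) ^ (β / 2) := by
      rw [← Real.rpow_two, ← Real.rpow_mul hn0.le]; congr 1; ring
    have e2 : (n : ℝ) ^ β = (n : ℝ) ^ (β / 2) * (n : ℝ) ^ (β / 2) := by
      rw [← Real.rpow_add hn0]; congr 1; ring
    have e3 : (⌈Real.logb 2 n⌉₊ : ℝ) ^ 2 ≤ (n : ℝ) ^ (β / 2) := by rw [← e1]; gcongr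
    push_cast
    rw [e2]
    nlinarith

lemma tendsto_error (h : 2 - 2 * γ < δ) :
    Tendsto (fun n : ℕ => 32 * (n : ℝ) ^ (-(δ / 2 + γ - 1)) + 3 * (1 / 2) ^ ⌈Real.logb 2 n⌉₊)
      atTop (𝓝 0) := by
  have h1 := (tendsto_natCast_rpow_neg (by linarith : -(δ / 2 + γ - 1) < 0)).const_mul 32
  have h2 := ((tendsto_pow_atTop_nhds_zero_of_lt_one (r := (1 / 2 : ℝ)) (by norm_num)
    (by norm_num)).comp tendsto_ceil_logb).const_mul 3
  simpa [Function.comp_def] using h1.add h2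

lemma four_div_le {n : ℕ} (hn : 1 ≤ n) {β μ : ℝ} (hμ : (n : ℝ) ^ β / 8 ≤ μ) :
    4 / μ ≤ 32 * (n : ℝ) ^ (-β) := by
  have hn0 : (0 : ℝ) < n := by exact_mod_cast hn
  calc 4 / μ ≤ 4 / ((n : ℝ) ^ β / 8) := by gcongr
    _ = 32 * (n : ℝ) ^ (-β) := by rw [Real.rpow_neg hn0.le]; field_simp; norm_num

/-- Algorithms that exist for all large `n` form a sequence, since for small `n` an algorithm may
stop without making a query. -/
lemma exists_seq_of_eventually_exists {α : ℕ → Type} [∀ n, Inhabited (α n)]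
    {good : ∀ n, QueryAlg n (α n) → Prop}
    (h : ∀ᶠ n : ℕ in atTop, ∃ T : QueryAlg n (α n), (T.queries : ℝ) ≤ (n : ℝ) ^ δ ∧ good n T) :
    ∃ T : ∀ n, QueryAlg n (α n), (∀ n, ((T n).queries : ℝ) ≤ (n : ℝ) ^ δ) ∧
      ∀ᶠ n in atTop, good n (T n) := by
  have hall : ∀ n : ℕ, ∃ T : QueryAlg n (α n), (T.queries : ℝ) ≤ (n : ℝ) ^ δ ∧
      ((∃ T : QueryAlg n (α n), (T.queries : ℝ) ≤ (n : ℝ) ^ δ ∧ good n T) → good n T) := by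
    intro n
    by_cases hn : ∃ T : QueryAlg n (α n), (T.queries : ℝ) ≤ (n : ℝ) ^ δ ∧ good n T
    · obtain ⟨T, h1, h2⟩ := hn
      exact ⟨T, h1, fun _ => h2⟩
    · exact ⟨.output default, by simp only [QueryAlg.queries, Nat.cast_zero]; positivity,
        fun h => absurd h hn⟩
  choose T hTq hT using hall
  exact ⟨T, hTq, h.mono fun n hn => hT n hn⟩

lemma detectionPossible (hγ : γ ∈ Set.Ioo (0 : ℝ) 1) (hδ : δ ∈ Set.Ioo (0 : ℝ) 2)
    (hk : ∀ n : ℕ, |(k n : ℝ) - (n : ℝ) ^ γ| < 1) (h : 2 - 2 * γ < δ) :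
    DetectionPossible k fun n => (n : ℝ) ^ δ := by
  let good (n : ℕ) (T : QueryAlg n Bool) : Prop := risk (k n) (PMF.pure T) ≤
    32 * (n : ℝ) ^ (-(δ / 2 + γ - 1)) + 3 * (1 / 2) ^ ⌈Real.logb 2 n⌉₊
  have hex : ∀ᶠ n : ℕ in atTop, ∃ T : QueryAlg n Bool, (T.queries : ℝ) ≤ (n : ℝ) ^ δ ∧
      good n T := by
    filter_upwards [eventually_exists_window hγ hδ hk h, eventually_ge_atTop 1]
      with n ⟨M, hM1, hM2, hM3⟩ hn1
    have hn0 : (0 : ℝ) < n := by exact_mod_cast hn1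
    have hpos : 0 < (M.card : ℝ) * (k n / n) := lt_of_lt_of_le (by positivity) hM2
    obtain ⟨T, hT, hTr⟩ := exists_detection_alg (size_le hγ hk n) (le_two_pow_ceil_logb n) M hpos
      ((mul_le_mul_of_nonneg_left (by exact_mod_cast Nat.le_add_left _ _) zero_le_two).trans hM3)
    refine ⟨T, ?_, ?_⟩
    · have : (T.queries : ℝ) ≤ (M.card : ℝ) ^ 2 := by exact_mod_cast hT
      linarith [Real.rpow_nonneg hn0.le δ]
    · change RandAlg.prob _ _ _ + RandAlg.prob _ _ _ ≤ _
      rw [RandAlg.prob_pure, RandAlg.prob_pure]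
      have := four_div_le hn1 hM2
      have : (0 : ℝ) ≤ (1 / 2) ^ ⌈Real.logb 2 n⌉₊ := by positivity
      linarith
  obtain ⟨T, hTq, hT⟩ := exists_seq_of_eventually_exists hex
  refine ⟨T, hTq, squeeze_zero' (.of_forall fun n => ?_) hT
    (tendsto_error h)⟩
  exact add_nonneg ENNReal.toReal_nonneg ENNReal.toReal_nonneg

lemma findingPossible (hγ : γ ∈ Set.Ioo (0 : ℝ) 1) (hδ : δ ∈ Set.Ioo (0 : ℝ) 2)
    (hk : ∀ n : ℕ, |(k n : ℝ) - (n : ℝ) ^ γ| < 1) (h : 2 - 2 * γ < δ) (h1 : 1 < δ) :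
    FindingPossible k fun n => (n : ℝ) ^ δ := by
  let good (n : ℕ) (T : QueryAlg n (Finset (Fin n))) : Prop :=
    1 - (32 * (n : ℝ) ^ (-(δ / 2 + γ - 1)) + 3 * (1 / 2) ^ ⌈Real.logb 2 n⌉₊) ≤
      successProb (k n) (PMF.pure T)
  have hex : ∀ᶠ n : ℕ in atTop, ∃ T : QueryAlg n (Finset (Fin n)),
      (T.queries : ℝ) ≤ (n : ℝ) ^ δ ∧ good n T := by
    filter_upwards [eventually_exists_window hγ hδ hk h, eventually_ge_atTop 1,
      eventually_ceil_logb_le_rpow (by linarith : 0 < (δ - 1) / 2),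
      eventually_le_natCast_rpow (by linarith : 0 < (δ - 1) / 2) 10,
      tendsto_ceil_logb.eventually_ge_atTop 1] with n ⟨M, hM1, hM2, hM3⟩ hn1 hL h10 hL1
    have hn0 : (0 : ℝ) < n := by exact_mod_cast hn1
    have hpos : 0 < (M.card : ℝ) * (k n / n) := lt_of_lt_of_le (by positivity) hM2
    obtain ⟨T, hT, hTr⟩ := exists_finding_alg (size_le hγ hk n) (le_two_pow_ceil_logb n) M hpos hM3
    refine ⟨T, ?_, ?_⟩
    · have hL1' : (1 : ℝ) ≤ ⌈Real.logb 2 n⌉₊ := by exact_mod_cast hL1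
      have hT' : (T.queries : ℝ) ≤ (M.card : ℝ) ^ 2 + (4 * ⌈Real.logb 2 n⌉₊ + 1) * n := by
        exact_mod_cast hT
      have e : (n : ℝ) ^ δ = (n : ℝ) ^ ((δ - 1) / 2) * (n : ℝ) ^ ((δ - 1) / 2) * n := by
        rw [← Real.rpow_add hn0]
        nth_rewrite 3 [← Real.rpow_one (n : ℝ)]
        rw [← Real.rpow_add hn0]
        congr 1; ring
      have e2 : (4 * (⌈Real.logb 2 n⌉₊ : ℝ) + 1) * n ≤ (n : ℝ) ^ δ / 2 := by
        rw [e, mul_div_right_comm]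
        gcongr
        nlinarith
      linarith [Real.rpow_nonneg hn0.le δ]
    · change _ ≤ RandAlg.prob _ _ _
      rw [RandAlg.prob_pure]
      have := four_div_le hn1 hM2
      linarith
  obtain ⟨T, hTq, hT⟩ := exists_seq_of_eventually_exists hex
  refine ⟨T, hTq, tendsto_of_tendsto_of_tendsto_of_le_of_le'
    (by simpa using (tendsto_error h).const_sub 1) tendsto_const_nhds
    hT (.of_forall fun n => ?_)⟩
  have := isProbabilityMeasure_P1 (size_le hγ hk n)
  exact RandAlg.prob_le _ _ _ fun _ _ => measureReal_le_one

end Algorithms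

end PlantedClique

theorem corollary1 (γ δ : ℝ) (hγ : γ ∈ Set.Ioo (0 : ℝ) 1) (hδ : δ ∈ Set.Ioo (0 : ℝ) 2)
    (k : ℕ → ℕ) (hk : ∀ n : ℕ, |(k n : ℝ) - (n : ℝ) ^ γ| < 1) :
    (δ < 2 - 2 * γ → DetectionImpossible k (fun n => (n : ℝ) ^ δ)) ∧
    (2 - 2 * γ < δ → δ < 1 →
      DetectionPossible k (fun n => (n : ℝ) ^ δ) ∧
      FindingImpossible k (fun n => (n : ℝ) ^ δ)) ∧
    (2 - 2 * γ < δ → 1 < δ → FindingPossible k (fun n => (n : ℝ) ^ δ)) :=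
  ⟨detectionImpossible hγ hk,
    fun h h1 => ⟨detectionPossible hγ hδ hk h, findingImpossible hγ hδ.1 hk h1⟩,
    findingPossible hγ hδ hk⟩
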